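/- For $n\geqslant 1$ let $\mathfrak S_n$ be the set of permutations $\pi=\pi(1)\cdots\pi(n)$ of $[n]$. A run of $\pi$ is a maximal segment of at least two consecutive entries that is increasing or decreasing, and $\mathrm{run}(\pi)$ is the number of runs of $\pi$ (so $\mathrm{run}(\pi)=0$ for $n=1$). Let $\mathrm{as}(\pi)$ be the largest $k$ for which there are $1\leqslant i_1<i_2<\cdots<i_k\leqslant n$ with $\pi(i_1)>\pi(i_2)<\pi(i_3)>\cdots\pi(i_k)$. Define the alternating run polynomials and the up-down run polynomials by $$R_n(x)=\sum_{\pi\in\mathfrak S_n}x^{\mathrm{run}(\pi)},\qquad S_n(x)=\sum_{\pi\in\mathfrak S_n}x^{\mathrm{as}(\pi)}.$$ Then for every $n\geqslant 1$, $$S_{n+1}(x)=(1+x)\sum_{r=1}^n\binom{n}{r-1}(-1)^{n-r}(1-x^2)^{\lfloor (n-r)/2\rfloor}S_r(x),$$ $$R_{n+1}(x)=(-1)^{n-1}(x-1)(1-x^2)^{\lfloor (n-1)/2\rfloor}+(1+x)\sum_{r=2}^{n+1}\binom{n}{r-2}(-1)^{n-r+1}(1-x^2)^{\lfloor (n-r+1)/2\rfloor}R_{r-1}(x).$$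 Moreover, in $\mathbb Z[x]$, $S_n(x)$ is divisible by $(1+x)^{\lfloor n/2\rfloor}$ for every $n\geqslant 1$, and $R_n(x)$ is divisible by $(1+x)^{\lfloor n/2\rfloor-1}$ for every $n\geqslant 2$ (for $n=1$ the exponent is negative and the claim is void). -/

import Mathlib

open Polynomial

/-- The segment of the word `w` from position `i` to position `j` has at least two letters and is
increasing or decreasing. -/
def IsMonotoneSegment {n : ℕ} (w : Fin n → Fin n) (i j : Fin n) : Prop :=
  i < j ∧ (StrictMonoOn w (Set.Icc i j) ∨ StrictAntiOn w (Set.Icc i j))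

/-- The segment from `i` to `j` is an (alternating) run of `w`: a monotone segment that is not
contained in any other monotone segment. -/
def IsRun {n : ℕ} (w : Fin n → Fin n) (i j : Fin n) : Prop :=
  IsMonotoneSegment w i j ∧
    ∀ i' j' : Fin n, i' ≤ i → j ≤ j' → IsMonotoneSegment w i' j' → i' = i ∧ j' = j

open Classical in
/-- The number of alternating runs of a permutation. -/
noncomputable def runCount {n : ℕ} (π : Equiv.Perm (Fin n)) : ℕ :=
  (Finset.univ.filter fun p : Fin n × Fin n => IsRun π p.1 p.2).card

/-- `w` has an alternating subsequence `w (i 0) > w (i 1) < w (i 2) > ⋯ w (i (k - 1))` of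
length `k`. -/
def HasAlternatingSubsequence {n : ℕ} (w : Fin n → Fin n) (k : ℕ) : Prop :=
  ∃ i : Fin k → Fin n, StrictMono i ∧
    ∀ a b : Fin k, (b : ℕ) = (a : ℕ) + 1 →
      (Even (a : ℕ) → w (i b) < w (i a)) ∧ (Odd (a : ℕ) → w (i a) < w (i b))

/-- Alternating subsequences have length at most `n`, so the supremum below is a maximum. -/
theorem HasAlternatingSubsequence.le {n : ℕ} {w : Fin n → Fin n} {k : ℕ}
    (h : HasAlternatingSubsequence w k) : k ≤ n := by
  obtain ⟨i, hi, -⟩ := h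
  simpa using Fintype.card_le_of_injective i hi.injective

/-- The length of the longest alternating subsequence of a permutation. -/
noncomputable def longestAlternating {n : ℕ} (π : Equiv.Perm (Fin n)) : ℕ :=
  sSup {k : ℕ | HasAlternatingSubsequence π k}

/-- The alternating run polynomial `R_n(x)`. -/
noncomputable def altRunPoly (n : ℕ) : ℤ[X] :=
  ∑ π : Equiv.Perm (Fin n), X ^ runCount π

/-- The up-down run polynomial `S_n(x)`. -/
noncomputable def upDownRunPoly (n : ℕ) : ℤ[X] :=
  ∑ π : Equiv.Perm (Fin n), X ^ longestAlternating π

/-! Put a letter 0, entered by a descent, before a permutation: `as` is then its number of direction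
changes. Inserting a new maximum gives S_{n+1} = (n x² + x) S_n + x(1 - x²) S_n'. The coefficients
I_k of `inverseCoeff` obey a companion recurrence such that A_n = ∑ C(n,j) I_{n-j} S_{j+1} satisfies
A_{n+1} = ((n+1)x² - 1) A_n + x(1 - x²) A_n'. As A_0 = x is sent to 0, A_n = 0 for n ≥ 1, which is
the recurrence for S.

Complementing letters pairs permutations so that x^as(π) + x^as(π') = (1+x) x^run(π); hence 2 S_n =
(1+x) R_n for n ≥ 2. This transfers everything to R, the exception n = 1 giving the extra term.
Divisibility follows from the recurrence by strong induction. -/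

/-! ### Direction changes under insertion of a maximum -/

/-- The number of changes of direction along the word `L`, when its first letter is preceded by
the letter `v` and the step into `v` is an ascent (`b = true`) or a descent (`b = false`). -/
def dirChanges : Bool → ℕ → List ℕ → ℕ
  | _, _, [] => 0
  | b, v, w :: L => (if b = decide (v < w) then 0 else 1) + dirChanges (decide (v < w)) w L

/-- The sum of `X ^ k'` over the numbers `k'` of changes of direction that arise when a new maximum
is inserted into a word of length `m` with `k` changes of direction. -/
noncomputable def insertionPoly (k m : ℕ) : ℤ[X] :=
  (k : ℤ[X]) * X ^ k + X ^ (k + 1) + ((m : ℤ[X]) - (k : ℤ[X])) * X ^ (k + 2)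

/-- The sum of `X ^ dirChanges b v L'` over the words `L'` obtained by inserting `M` into `L`. -/
noncomputable def insertionSum (M : ℕ) (b : Bool) (v : ℕ) (L : List ℕ) : ℤ[X] :=
  ((L.permutations'Aux M).map fun L' => (X : ℤ[X]) ^ dirChanges b v L').sum

theorem insertionSum_nil (M : ℕ) (b : Bool) (v : ℕ) (hv : v < M) :
    insertionSum M b v [] = if b then 1 else X := by
  cases b <;> simp [insertionSum, List.permutations'Aux, dirChanges, hv]

theorem insertionSum_cons (M : ℕ) (b : Bool) (v w : ℕ) (L : List ℕ) (hv : v < M) (hw : w < M) :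
    insertionSum M b v (w :: L) =
      X ^ ((if b then 1 else 2) + dirChanges false w L) +
        X ^ (if b = decide (v < w) then 0 else 1) * insertionSum M (decide (v < w)) w L := by
  have h : ¬ M < w := by omega
  cases b <;> by_cases hvw : v < w <;>
    simp [insertionSum, List.permutations'Aux, dirChanges, hv, h, hvw, pow_add,
      Function.comp_def, List.sum_map_mul_left, pow_succ, mul_assoc]

/-- The second identity is the first one for `v :: L` placed after a smaller letter entered by a
descent: the subtracted power is the insertion before `v`. Carrying both closes the induction. -/
theorem insertionSum_eq (M : ℕ) (L : List ℕ) : ∀ v < M, (∀ w ∈ L, w < M) →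
    insertionSum M false v L = insertionPoly (dirChanges false v L) L.length ∧
    X * insertionSum M true v L = insertionPoly (dirChanges true v L + 1) (L.length + 1) -
      X ^ (2 + dirChanges false v L) := by
  induction L with
  | nil =>
    intro v hv _
    simp [insertionSum_nil _ _ _ hv, insertionPoly, dirChanges]
  | cons w L ih =>
    intro v hv hL
    have hw : w < M := hL w (by simp)
    obtain ⟨h1, h2⟩ := ih w hw fun u hu => hL u (by simp [hu])
    rw [insertionSum_cons _ _ _ _ _ hv hw, insertionSum_cons _ _ _ _ _ hv hw]
    by_cases hvw : v < w
    · simp only [dirChanges, hvw, decide_true, Bool.false_eq_true, if_false, if_true, pow_one,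
        pow_zero, one_mul, mul_add, h2, List.length_cons]
      constructor
      · rw [add_comm 1]; ring
      · simp only [insertionPoly]; push_cast; ring
    · simp only [dirChanges, hvw, decide_false, Bool.false_eq_true, if_false, if_true, pow_one,
        pow_zero, one_mul, h1, List.length_cons, Bool.true_eq_false]
      constructor
      · simp only [insertionPoly]; push_cast; ring
      · simp only [insertionPoly]; push_cast; ring

/-- The word `n, n - 1, …, 1`. -/
def downTo : ℕ → List ℕ
  | 0 => []
  | n + 1 => (n + 1) :: downTo n

theorem mem_downTo {n k : ℕ} : k ∈ downTo n ↔ 1 ≤ k ∧ k ≤ n := by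
  induction n with
  | zero => simp [downTo]; omega
  | succ n ih => simp [downTo, ih]; omega

theorem length_downTo (n : ℕ) : (downTo n).length = n := by
  induction n with
  | zero => rfl
  | succ n ih => simp [downTo, ih]

theorem nodup_downTo (n : ℕ) : (downTo n).Nodup := by
  induction n with
  | zero => simp [downTo]
  | succ n ih => simp [downTo, ih, mem_downTo]

/-- The words of the permutations of `1, …, n`, counted by changes of direction. -/
noncomputable def wordPoly (n : ℕ) : ℤ[X] :=
  ((downTo n).permutations'.map fun L => (X : ℤ[X]) ^ dirChanges false 0 L).sum

theorem wordPoly_succ (n : ℕ) :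
    wordPoly (n + 1) = ((n : ℤ[X]) * X ^ 2 + X) * wordPoly n +
      X * (1 - X ^ 2) * derivative (wordPoly n) := by
  have key : wordPoly (n + 1) = ((downTo n).permutations'.map fun L =>
      insertionPoly (dirChanges false 0 L) n).sum := by
    rw [wordPoly, downTo, List.permutations', List.map_flatMap, List.flatMap, List.sum_flatten,
      List.map_map]
    congr 1
    refine List.map_congr_left fun L hL => ?_
    have hp := List.mem_permutations'.1 hL
    have hl : L.length = n := hp.length_eq.trans (length_downTo n)
    have := (insertionSum_eq (n + 1) L 0 (by omega) fun w hw => by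
      have := mem_downTo.1 (hp.mem_iff.1 hw); omega).1
    rw [hl] at this
    exact this
  rw [key, wordPoly]
  generalize (downTo n).permutations' = l
  induction l with
  | nil => simp
  | cons L l ih =>
    simp only [List.map_cons, List.sum_cons, ih, derivative_add, derivative_X_pow]
    -- The derivative of `X ^ k` involves the truncated exponent `k - 1`, so 0 is separated.
    rcases dirChanges false 0 L with _ | k
    · simp [insertionPoly]; ring
    · simp [insertionPoly]; ring

/-! ### Binomial convolution and divisibility of S_n -/

/-- The coefficients of the inverse of the sequence `wordPoly (n + 1)` with respect to binomial
convolution, up to the factor `X`. -/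
noncomputable def inverseCoeff : ℕ → ℤ[X]
  | 0 => 1
  | k + 1 => -(1 + X) * ((-1) ^ k * (1 - X ^ 2) ^ (k / 2))

theorem inverseCoeff_succ (k : ℕ) :
    inverseCoeff (k + 1) = ((k : ℤ[X]) * X ^ 2 - 1 - X) * inverseCoeff k +
      X * (1 - X ^ 2) * derivative (inverseCoeff k) := by
  rcases k with _ | k
  · simp [inverseCoeff]; ring
  rcases Nat.even_or_odd' k with ⟨m, rfl | rfl⟩
  · have h1 : (2 * m + 1) / 2 = m := by omega
    have h2 : 2 * m / 2 = m := by omega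
    simp only [inverseCoeff, h1, h2, pow_succ (-1 : ℤ[X]), pow_mul (-1 : ℤ[X])]
    rcases m with _ | m
    · simp; ring
    · simp [derivative_pow]; ring
  · have h1 : (2 * m + 1 + 1) / 2 = m + 1 := by omega
    have h2 : (2 * m + 1) / 2 = m := by omega
    simp only [inverseCoeff, h1, h2, pow_succ (-1 : ℤ[X]), pow_mul (-1 : ℤ[X])]
    rcases m with _ | m
    · simp; ring
    · simp [derivative_pow]; ring

theorem sum_choose_succ_mul_mul (n : ℕ) (g T : ℕ → ℤ[X]) :
    ∑ j ∈ Finset.range (n + 2), ((n + 1).choose j : ℤ[X]) * g (n + 1 - j) * T j =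
      ∑ j ∈ Finset.range (n + 1),
        (n.choose j : ℤ[X]) * (g (n - j + 1) * T j + g (n - j) * T (j + 1)) := by
  have := Finset.sum_choose_succ_mul (R := ℤ[X]) (fun i j => T i * g j) n
  simp only [mul_add, Finset.sum_add_distrib]
  rw [show (∑ j ∈ Finset.range (n + 2), ((n + 1).choose j : ℤ[X]) * g (n + 1 - j) * T j) =
    ∑ j ∈ Finset.range (n + 2), ((n + 1).choose j : ℤ[X]) * (T j * g (n + 1 - j)) from
    Finset.sum_congr rfl fun j _ => by ring, this]
  congr 1
  · refine Finset.sum_congr rfl fun j hj => ?_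
    rw [show n + 1 - j = n - j + 1 by have := Finset.mem_range.1 hj; omega]; ring
  · exact Finset.sum_congr rfl fun j _ => by ring

/-- By Pascal's rule, each summand combines the two recurrences. The derivative terms form a product
rule, and `(n - j) + (j + 1)` no longer depends on `j`. -/
theorem sum_inverseCoeff_mul_succ (T : ℕ → ℤ[X])
    (hT : ∀ j : ℕ, T (j + 1) = (((j : ℤ[X]) + 1) * X ^ 2 + X) * T j +
      X * (1 - X ^ 2) * derivative (T j)) (n : ℕ) :
    ∑ j ∈ Finset.range (n + 2), ((n + 1).choose j : ℤ[X]) * inverseCoeff (n + 1 - j) * T j =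
      ((n : ℤ[X]) * X ^ 2 + X ^ 2 - 1) *
          (∑ j ∈ Finset.range (n + 1), (n.choose j : ℤ[X]) * inverseCoeff (n - j) * T j) +
        X * (1 - X ^ 2) * derivative
          (∑ j ∈ Finset.range (n + 1), (n.choose j : ℤ[X]) * inverseCoeff (n - j) * T j) := by
  rw [sum_choose_succ_mul_mul, derivative_sum, Finset.mul_sum, Finset.mul_sum,
    ← Finset.sum_add_distrib]
  refine Finset.sum_congr rfl fun j hj => ?_
  have hj : j ≤ n := by have := Finset.mem_range.1 hj; omega
  rw [hT, inverseCoeff_succ, Nat.cast_sub hj]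
  simp only [derivative_mul, derivative_natCast]
  ring

theorem sum_inverseCoeff_mul_eq_zero (T : ℕ → ℤ[X]) (h0 : T 0 = X)
    (hT : ∀ j : ℕ, T (j + 1) = (((j : ℤ[X]) + 1) * X ^ 2 + X) * T j +
      X * (1 - X ^ 2) * derivative (T j)) (n : ℕ) :
    ∑ j ∈ Finset.range (n + 2), ((n + 1).choose j : ℤ[X]) * inverseCoeff (n + 1 - j) * T j = 0 := by
  induction n with
  | zero =>
    rw [sum_inverseCoeff_mul_succ T hT]
    simp [h0, inverseCoeff]; ring
  | succ n ih =>
    rw [sum_inverseCoeff_mul_succ T hT, ih]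
    simp

theorem wordPoly_one : wordPoly 1 = X := by
  simp [wordPoly, downTo, List.permutations', List.permutations'Aux, dirChanges]

theorem wordPoly_convolution (n : ℕ) (hn : 1 ≤ n) :
    wordPoly (n + 1) = (1 + X) * ∑ r ∈ Finset.Icc 1 n,
      (n.choose (r - 1) : ℤ[X]) * (-1) ^ (n - r) * (1 - X ^ 2) ^ ((n - r) / 2) * wordPoly r := by
  obtain ⟨n, rfl⟩ := Nat.exists_eq_add_of_le' hn
  have h := sum_inverseCoeff_mul_eq_zero (fun j => wordPoly (j + 1)) wordPoly_one
    (fun j => by simpa using wordPoly_succ (j + 1)) n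
  rw [Finset.sum_range_succ] at h
  simp only [Nat.choose_self, Nat.cast_one, Nat.sub_self, show inverseCoeff 0 = 1 from rfl, one_mul] at h
  rw [← sub_eq_zero, ← h, Finset.range_eq_Ico, ← Finset.Ico_succ_right_eq_Icc,
    Finset.sum_Ico_eq_sum_range, Finset.sum_Ico_eq_sum_range, sub_eq_add_neg, add_comm,
    Finset.mul_sum, ← Finset.sum_neg_distrib]
  congr 1
  simp only [Order.succ_eq_add_one, Nat.add_sub_cancel, Nat.sub_zero]
  refine Finset.sum_congr rfl fun j hj => ?_
  have hj := Finset.mem_range.1 hj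
  rw [show n + 1 - (0 + j) = n - j + 1 by omega, show n + 1 - (1 + j) = n - j by omega,
    show 1 + j - 1 = j by omega, inverseCoeff, zero_add, add_comm 1 j]
  ring

theorem pow_dvd_wordPoly (n : ℕ) (hn : 1 ≤ n) : (1 + X) ^ (n / 2) ∣ wordPoly n := by
  induction n using Nat.strong_induction_on with
  | _ n ih =>
    obtain ⟨n, rfl⟩ := Nat.exists_eq_add_of_le' hn
    rcases Nat.eq_zero_or_pos n with rfl | hn
    · simp
    rw [wordPoly_convolution n hn, show (n + 1) / 2 = 1 + (n - 1) / 2 by omega, pow_add, pow_one]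
    refine mul_dvd_mul_left _ (Finset.dvd_sum fun r hr => ?_)
    obtain ⟨hr1, hr2⟩ := Finset.mem_Icc.1 hr
    have h1 : ((1 : ℤ[X]) + X) ^ ((n - r) / 2) ∣ (1 - X ^ 2) ^ ((n - r) / 2) :=
      pow_dvd_pow_of_dvd ⟨1 - X, by ring⟩ _
    -- One factor comes from the prefactor `1 + X`; the rest from `1 - X ^ 2` and from the induction
    -- hypothesis for `r`.
    refine (pow_dvd_pow _ (show (n - 1) / 2 ≤ (n - r) / 2 + r / 2 by omega)).trans ?_
    rw [pow_add]
    exact mul_dvd_mul (h1.mul_left _) (ih r (by omega) hr1)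

/-! ### Longest alternating subsequences as direction changes -/

/-- The word `π(1) ⋯ π(n)` of a permutation, with letters `1, …, n`. -/
def permWord {n : ℕ} (w : Fin n → Fin n) : List ℕ :=
  List.ofFn fun i => (w i : ℕ) + 1

theorem sum_perm_eq_sum_permutations {n : ℕ} (f : List ℕ → ℤ[X]) :
    ∑ π : Equiv.Perm (Fin n), f (permWord π) = ((downTo n).permutations'.map f).sum := by
  have hnd : (downTo n).permutations'.Nodup := 
    (List.permutations_perm_permutations' _).nodup_iff.1
      (List.nodup_permutations _ (nodup_downTo n))
  rw [← List.sum_toFinset _ hnd]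
  have hinj : Function.Injective fun π : Equiv.Perm (Fin n) => permWord π := by
    intro π σ h
    have := List.ofFn_injective h
    ext i
    simpa using congrFun this i
  rw [← Finset.sum_image (f := f) (s := Finset.univ)
    (g := fun π : Equiv.Perm (Fin n) => permWord π) fun _ _ _ _ h => hinj h]
  congr 1
  refine Finset.eq_of_subset_of_card_le ?_ ?_
  · intro L hL
    obtain ⟨π, -, rfl⟩ := Finset.mem_image.1 hL
    rw [List.mem_toFinset, List.mem_permutations', List.perm_ext_iff_of_nodup _ (nodup_downTo n)]
    · intro k
      rw [mem_downTo, permWord, List.mem_ofFn]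
      constructor
      · rintro ⟨i, rfl⟩
        have := (π i).2
        omega
      · rintro ⟨h1, h2⟩
        refine ⟨π.symm ⟨k - 1, by omega⟩, ?_⟩
        simp; omega
    · rw [permWord, List.nodup_ofFn]
      intro i j h
      exact π.injective (Fin.ext (by simpa using h))
  · rw [Finset.card_image_of_injective _ hinj, List.toFinset_card_of_nodup hnd,
      (List.permutations_perm_permutations' _).length_eq.symm, List.length_permutations,
      length_downTo, Finset.card_univ, Fintype.card_perm, Fintype.card_fin]

/-- Consecutive letters of the word alternately increase and decrease, beginning with an ascent
(`b = true`) or a descent (`b = false`). -/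
def Alternates : Bool → List ℕ → Prop
  | b, x :: y :: l => (if b then x < y else y < x) ∧ Alternates (!b) (y :: l)
  | _, _ => True

theorem Alternates.tail {b : Bool} {x : ℕ} {l : List ℕ} (h : Alternates b (x :: l)) :
    Alternates (!b) l := by
  cases l with
  | nil => simp [Alternates]
  | cons y l => exact h.2

theorem alternates_ofFn_iff {k : ℕ} : ∀ (b : Bool) (g : Fin k → ℕ),
    Alternates b (List.ofFn g) ↔ ∀ i j : Fin k, (j : ℕ) = (i : ℕ) + 1 →
      (Even (i : ℕ) → if b then g i < g j else g j < g i) ∧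
      (Odd (i : ℕ) → if b then g j < g i else g i < g j) := by
  induction k with
  | zero => intro b g; simp [Alternates]
  | succ k ih =>
    intro b g
    rcases k with _ | k
    · simp [Alternates]
    · have := ih (!b) fun i => g i.succ
      rw [List.ofFn_succ] at this
      rw [List.ofFn_succ, List.ofFn_succ, Alternates, this]
      constructor
      · rintro ⟨h0, h⟩ i j hij
        obtain ⟨j, rfl⟩ := Fin.exists_succ_eq.2 (show j ≠ 0 by rintro rfl; simp at hij)
        rcases Fin.eq_zero_or_eq_succ i with rfl | ⟨i, rfl⟩
        · have : j = 0 := by ext; simpa using hij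
          subst this
          simpa using h0
        · have := h i j (by simpa using hij)
          simp only [Fin.val_succ, Nat.even_add_one, Nat.odd_add_one, Nat.not_even_iff_odd,
            Nat.not_odd_iff_even]
          cases b <;> simpa using this.symm
      · intro h
        refine ⟨by simpa using (h 0 (Fin.succ 0) (by simp)).1 (by simp), fun i j hij => ?_⟩
        have := h i.succ j.succ (by simpa using hij)
        simp only [Fin.val_succ, Nat.even_add_one, Nat.odd_add_one, Nat.not_even_iff_odd,
            Nat.not_odd_iff_even] at this
        cases b <;> simpa using this.symm

theorem hasAlternatingSubsequence_iff {n : ℕ} (w : Fin n → Fin n) (k : ℕ) :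
    HasAlternatingSubsequence w k ↔
      ∃ s, s.Sublist (permWord w) ∧ Alternates false s ∧ s.length = k := by
  constructor
  · rintro ⟨i, hi, h⟩
    refine ⟨List.ofFn fun a => (w (i a) : ℕ) + 1, ?_, ?_, by simp⟩
    · rw [List.sublist_iff_exists_fin_orderEmbedding_get_eq]
      have h1 : (List.ofFn fun a => (w (i a) : ℕ) + 1).length = k := by simp
      have h2 : (permWord w).length = n := by simp [permWord]
      refine ⟨OrderEmbedding.ofStrictMono (fun a => (i (a.cast h1)).cast h2.symm) ?_, ?_⟩
      · intro a b hab
        exact hi (show a.cast h1 < b.cast h1 from hab)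
      · intro a
        simp [permWord]
        rfl
    · rw [alternates_ofFn_iff]
      intro a b hab
      simpa using h a b hab
  · rintro ⟨s, hs, ha, rfl⟩
    obtain ⟨f, hf⟩ := List.sublist_iff_exists_fin_orderEmbedding_get_eq.1 hs
    have h2 : (permWord w).length = n := by simp [permWord]
    have hs' : s = List.ofFn fun a => (w ((f a).cast h2) : ℕ) + 1 := by
      conv_lhs => rw [← List.ofFn_get s]
      congr 1
      funext a
      rw [hf]
      simp [permWord]
      rfl
    rw [hs', alternates_ofFn_iff] at ha
    refine ⟨fun a => (f (a.cast (by simp))).cast h2, ?_, ?_⟩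
    · intro a b hab
      exact f.strictMono hab
    · intro a b hab
      simpa using ha (a.cast (by simp)) (b.cast (by simp)) hab

theorem dirChanges_le (b b' : Bool) (v : ℕ) (L : List ℕ) :
    dirChanges b v L ≤ 1 + dirChanges b' v L := by
  cases L with
  | nil => simp [dirChanges]
  | cons w L => simp only [dirChanges]; split_ifs <;> omega

/-- If `s` starts at `v` and the step to `w` goes in direction `b`, a change pays for `v`. Otherwise
`w` is a better starting letter than `v` and can replace it. -/
theorem Alternates.length_le (L : List ℕ) : ∀ (v : ℕ) (b : Bool) (s : List ℕ),
    s.Sublist (v :: L) → Alternates b s → s.length ≤ 1 + dirChanges (!b) v L := by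
  induction L with
  | nil =>
    intro v b s hs _
    simpa [dirChanges] using hs.length_le
  | cons w L ih =>
    intro v b s hs ha
    rcases List.sublist_cons_iff.1 hs with hs' | ⟨s, rfl, hs'⟩
    · refine (ih w b s hs' ha).trans ?_
      simp only [dirChanges]
      have := dirChanges_le (!b) (decide (v < w)) w L
      split_ifs with h
      · rw [h]; omega
      · omega
    · by_cases hb : b = decide (v < w)
      · have h := ih w (!b) s hs' ha.tail
        have hne : ¬ (!b) = b := by cases b <;> simp
        simp only [dirChanges, ← hb, hne, if_false, List.length_cons]
        simp only [Bool.not_not] at h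
        omega
      · have hb' : (!b) = decide (v < w) := by
          cases b <;> cases h : decide (v < w) <;> simp_all
        simp only [dirChanges, ← hb', if_true, zero_add]
        rcases s with _ | ⟨x, s⟩
        · simp
        · have hx : if b then w < x else x < w := by
            have := ha.1
            cases b
            · have h : v < w := by simpa using hb'
              simp at this ⊢; omega
            · have h : w ≤ v := by simpa using hb'
              simp at this ⊢; omega
          have hxw : x ≠ w := by rintro rfl; cases b <;> simp at hx
          refine ih w b (w :: x :: s) ?_ ⟨hx, ha.2⟩
          rcases List.sublist_cons_iff.1 hs' with hs' | ⟨t, ht, -⟩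
          · exact hs'.cons_cons w
          · exact absurd (List.cons.inj ht).1 hxw

/-- The final inequality, that the head is at least as extreme as `v`, is what allows a letter to be
prepended at a turning point. -/
theorem exists_alternates (L : List ℕ) : ∀ (v : ℕ) (b : Bool), (v :: L).Nodup →
    ∃ h s, (h :: s).Sublist (v :: L) ∧ Alternates b (h :: s) ∧
      (h :: s).length = 1 + dirChanges (!b) v L ∧ if b then h ≤ v else v ≤ h := by
  induction L with
  | nil =>
    intro v b _
    exact ⟨v, [], List.Sublist.refl _, by simp [Alternates], by simp [dirChanges], by simp⟩
  | cons w L ih =>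
    intro v b hnd
    have hvw : v ≠ w := by rintro rfl; simp at hnd
    have hnd' := (List.nodup_cons.1 hnd).2
    by_cases hb : b = decide (v < w)
    · obtain ⟨h, s, hs, ha, hl, hh⟩ := ih w (!b) hnd'
      refine ⟨v, h :: s, hs.cons_cons v, ⟨?_, ha⟩, ?_, by simp⟩
      · cases b
        · have : w ≤ v := by simpa using hb
          simp at hh ⊢; omega
        · have : v < w := by simpa using hb
          simp at hh ⊢; omega
      · have hne : ¬ (!b) = b := by cases b <;> simp
        simp only [dirChanges, ← hb, hne, if_false, List.length_cons]
        simp only [Bool.not_not, List.length_cons] at hl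
        omega
    · have hb' : (!b) = decide (v < w) := by
        cases b <;> cases h : decide (v < w) <;> simp_all
      obtain ⟨h, s, hs, ha, hl, hh⟩ := ih w b hnd'
      refine ⟨h, s, hs.cons v, ha, ?_, ?_⟩
      · simpa only [dirChanges, ← hb', if_true, zero_add] using hl
      · cases b
        · have : v < w := by simpa using hb'
          simp at hh ⊢; omega
        · have : w ≤ v := by simpa using hb'
          simp at hh ⊢; omega

theorem nodup_permWord {n : ℕ} (π : Equiv.Perm (Fin n)) : (permWord π).Nodup := by
  rw [permWord, List.nodup_ofFn]
  intro i j h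
  exact π.injective (Fin.ext (by simpa using h))

theorem longestAlternating_eq {n : ℕ} (π : Equiv.Perm (Fin n)) :
    longestAlternating π = dirChanges false 0 (permWord π) := by
  refine IsGreatest.csSup_eq ?_
  have hpos : ∀ x ∈ permWord π, 0 < x := by
    intro x hx
    obtain ⟨i, rfl⟩ := (List.mem_ofFn' _ _).1 hx
    simp
  have hnd := nodup_permWord π
  simp only [IsGreatest, upperBounds, hasAlternatingSubsequence_iff, Set.mem_ofPred_eq]
  generalize permWord π = l at *
  rcases l with _ | ⟨v, L⟩
  · simp [dirChanges, Alternates]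
  · have hv : 0 < v := hpos v (by simp)
    have : dirChanges false 0 (v :: L) = 1 + dirChanges true v L := by simp [dirChanges, hv]
    rw [this]
    constructor
    · obtain ⟨h, s, hs, ha, hl, -⟩ := exists_alternates L v false hnd
      exact ⟨_, hs, ha, hl⟩
    · rintro k ⟨s, hs, ha, rfl⟩
      exact Alternates.length_le L v false s hs ha

theorem upDownRunPoly_eq (n : ℕ) : upDownRunPoly n = wordPoly n := by
  simp only [upDownRunPoly, longestAlternating_eq]
  exact sum_perm_eq_sum_permutations fun L => X ^ dirChanges false 0 L

/-! ### Runs as direction changes -/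

theorem isMonotoneSegment_iff {n : ℕ} {w : Fin n → Fin n} (hw : Function.Injective w) {g : ℕ → ℕ}
    (hg : ∀ i : Fin n, g i = w i + 1) (i j : Fin n) :
    IsMonotoneSegment w i j ↔ i < j ∧ ∃ b : Bool, ∀ k : ℕ, (i : ℕ) ≤ k → k < j →
      decide (g k < g (k + 1)) = b := by
  have hlt : ∀ a b : Fin n, w a < w b ↔ g a < g b := by
    intro a b; rw [hg, hg, Fin.lt_def]; omega
  have hne : ∀ k : ℕ, k + 1 < n → g k ≠ g (k + 1) := by
    intro k hk h
    rw [hg ⟨k, by omega⟩, hg ⟨k + 1, hk⟩] at h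
    have := hw (Fin.ext (Nat.succ.inj h))
    simp at this
  refine and_congr_right fun hij => ⟨?_, ?_⟩
  · rintro (h | h)
    · refine ⟨true, fun k hik hkj => ?_⟩
      have hj := j.2
      have := (hlt ⟨k, by omega⟩ ⟨k + 1, by omega⟩).1
        (h ⟨hik, Fin.le_def.2 (by simp; omega)⟩
          ⟨Fin.le_def.2 (by simp; omega), Fin.le_def.2 (by simp; omega)⟩
          (Fin.lt_def.2 (by simp)))
      simpa using this
    · refine ⟨false, fun k hik hkj => ?_⟩
      have hj := j.2
      have := (hlt ⟨k + 1, by omega⟩ ⟨k, by omega⟩).1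
        (h ⟨hik, Fin.le_def.2 (by simp; omega)⟩
          ⟨Fin.le_def.2 (by simp; omega), Fin.le_def.2 (by simp; omega)⟩
          (Fin.lt_def.2 (by simp)))
      simpa using this.le
  · rintro ⟨b, h⟩
    cases b
    · right
      have key : ∀ a c : ℕ, (i : ℕ) ≤ a → a + 1 ≤ c → c ≤ j → g c < g a := by
        intro a c hia hac
        induction c, hac using Nat.le_induction with
        | base =>
          intro haj
          have h1 := h a hia (by omega)
          have h2 := hne a (by omega)
          simp at h1; omega
        | succ c hc ih =>
          intro haj
          have h1 := h c (by omega) (by omega)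
          have h2 := ih (by omega)
          simp at h1; omega
      intro a ha c hc hac
      exact (hlt _ _).2 (key a c ha.1 hac hc.2)
    · left
      have key : ∀ a c : ℕ, (i : ℕ) ≤ a → a + 1 ≤ c → c ≤ j → g a < g c := by
        intro a c hia hac
        induction c, hac using Nat.le_induction with
        | base =>
          intro haj
          simpa using h a hia (by omega)
        | succ c hc ih =>
          intro haj
          have h1 := h c (by omega) (by omega)
          have h2 := ih (by omega)
          simp at h1; omega
      intro a ha c hc hac
      exact (hlt _ _).2 (key a c ha.1 hac hc.2)

/-- A run is determined by its left end, which is the first position or a turning point; its right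
end is the farthest one keeping the segment monotone. -/
theorem runCount_eq_card {n : ℕ} (π : Equiv.Perm (Fin n)) {g : ℕ → ℕ}
    (hg : ∀ i : Fin n, g i = π i + 1) :
    runCount π = ((Finset.range (n - 1)).filter fun i =>
      i = 0 ∨ decide (g (i - 1) < g i) ≠ decide (g i < g (i + 1))).card := by
  classical
  have hseg := isMonotoneSegment_iff π.injective hg
  unfold runCount
  refine Finset.card_nbij (fun p => (p.1 : ℕ)) ?_ ?_ ?_
  · rintro ⟨i, j⟩ hp
    simp only [Finset.mem_coe, Finset.mem_filter, Finset.mem_univ, true_and, Finset.mem_range]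
      at hp ⊢
    obtain ⟨hm, hmax⟩ := hp
    obtain ⟨hij, b, hb⟩ := (hseg _ _).1 hm
    have hj := j.2
    have hij' : (i : ℕ) < j := hij
    refine ⟨by omega, ?_⟩
    by_contra! hcon
    obtain ⟨hi0, heq⟩ := hcon
    have := (hmax ⟨i - 1, by omega⟩ j (Fin.le_def.2 (by simp)) le_rfl
      ((hseg _ _).2 ⟨Fin.lt_def.2 (by simp; omega), b, fun k hk1 hk2 => ?_⟩)).1
    · have := congrArg Fin.val this
      simp at this; omega
    · simp only at hk1
      rcases Nat.lt_or_ge k i with hki | hki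
      · have hk : k = i - 1 := by omega
        have hk' : k + 1 = i := by omega
        rw [hk', hk, heq]
        exact hb i le_rfl hij'
      · exact hb k hki hk2
  · rintro ⟨i, j⟩ hp ⟨i', j'⟩ hp' h
    simp only [Finset.coe_filter, Finset.mem_univ, true_and, Set.mem_ofPred_eq] at hp hp' h
    obtain rfl := Fin.ext h
    rcases le_total j j' with hj | hj
    · rw [(hp.2 i j' le_rfl hj hp'.1).2]
    · rw [(hp'.2 i j le_rfl hj hp.1).2]
  · intro i hi
    simp only [Finset.coe_filter, Finset.mem_range, Set.mem_ofPred_eq] at hi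
    obtain ⟨hin, hi⟩ := hi
    let I : Fin n := ⟨i, by omega⟩
    have hne : (Finset.univ.filter fun j : Fin n => IsMonotoneSegment π I j).Nonempty := by
      refine ⟨⟨i + 1, by omega⟩, ?_⟩
      simp only [Finset.mem_filter, Finset.mem_univ, true_and, hseg]
      refine ⟨Fin.lt_def.2 (by simp [I]), decide (g i < g (i + 1)), fun k h1 h2 => ?_⟩
      have : k = i := by simp [I] at h1 h2; omega
      rw [this]
    obtain ⟨j, hj, hmax⟩ := Finset.exists_max_image _ id hne
    simp only [Finset.mem_filter, Finset.mem_univ, true_and, id] at hj hmax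
    refine ⟨(I, j), ?_, rfl⟩
    simp only [Finset.coe_filter, Finset.mem_univ, true_and, Set.mem_ofPred_eq]
    refine ⟨hj, fun i' j' hi' hj' hm => ?_⟩
    obtain ⟨hlt, b, hb⟩ := (hseg _ _).1 hm
    have hIj : i < (j : ℕ) := hj.1
    have hjj : (j : ℕ) ≤ j' := hj'
    have hii : (i' : ℕ) ≤ i := hi'
    have hI : i' = I := by
      by_contra hcon
      have hlt' : (i' : ℕ) < i := lt_of_le_of_ne hii fun h => hcon (Fin.ext h)
      rcases hi with rfl | hi
      · omega
      · apply hi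
        have h1 := hb (i - 1) (by omega) (by omega)
        rw [show i - 1 + 1 = i by omega] at h1
        rw [h1, hb i hii (by omega)]
    subst hI
    exact ⟨rfl, le_antisymm (hmax j' hm) hj'⟩

theorem dirChanges_ofFn (m : ℕ) : ∀ (b : Bool) (g : ℕ → ℕ),
    dirChanges b (g 0) (List.ofFn fun i : Fin m => g (i + 1)) =
      ((Finset.range m).filter fun i =>
        (if i = 0 then b else decide (g (i - 1) < g i)) ≠ decide (g i < g (i + 1))).card := by
  induction m with
  | zero => intro b g; simp [dirChanges]
  | succ m ih =>
    intro b g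
    have := ih (decide (g 0 < g 1)) fun i => g (i + 1)
    rw [List.ofFn_succ, dirChanges, Finset.card_filter, Finset.sum_range_succ', add_comm]
    simp only [Fin.val_zero, zero_add, Fin.val_succ] at this ⊢
    rw [this, Finset.card_filter]
    congr 1
    · refine Finset.sum_congr rfl fun i _ => ?_
      rcases i with _ | i <;> simp
    · simp

theorem runCount_eq {n : ℕ} (π : Equiv.Perm (Fin n)) {v w : ℕ} {L : List ℕ}
    (h : permWord π = v :: w :: L) : runCount π = 1 + dirChanges (decide (v < w)) w L := by
  set g : ℕ → ℕ := fun i => (permWord π).getD i 0 with hgdef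
  have hg : ∀ i : Fin n, g i = π i + 1 := by
    intro i
    simp [g, permWord]
  have hn : n = L.length + 2 := by
    have := congrArg List.length h
    simpa [permWord] using this
  rw [runCount_eq_card π hg]
  have hv : g 0 = v := by simp [g, h]
  have hw : g 1 = w := by simp [g, h]
  have hL : (List.ofFn fun i : Fin (L.length + 1) => g (i + 1)) = w :: L := by
    refine List.ext_getElem (by simp) fun i h1 h2 => ?_
    simp [g, h]
  -- An initial direction opposite to the first step forces a change at position 0, matching the
  -- clause `i = 0`.
  have key := dirChanges_ofFn (L.length + 1) (!decide (v < w)) g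
  rw [hL, hv, dirChanges] at key
  have hne : ¬ (!decide (v < w)) = decide (v < w) := by cases decide (v < w) <;> simp
  rw [if_neg hne] at key
  rw [key, show n - 1 = L.length + 1 by omega]
  congr 1
  refine Finset.filter_congr fun i _ => ?_
  rcases i with _ | i
  · simp only [true_or, if_true, zero_add, hv, hw, true_iff]
    exact hne
  · simp

/-! ### Complementation and transfer to R_n -/

theorem dirChanges_complement (N : ℕ) (L : List ℕ) : ∀ (b : Bool) (v : ℕ),
    (v :: L).Nodup → (∀ x ∈ v :: L, x ≤ N) →
      dirChanges b (N - v) (L.map fun x => N - x) = dirChanges (!b) v L := by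
  induction L with
  | nil => intro b v _ _; simp [dirChanges]
  | cons w L ih =>
    intro b v hnd hN
    have hvw : v ≠ w := by rintro rfl; simp at hnd
    have h1 := hN v (by simp)
    have h2 := hN w (by simp)
    have h3 : decide (N - v < N - w) = !decide (v < w) := by
      by_cases h : v < w
      · simp [h]; omega
      · simp [h]; omega
    rw [List.map_cons, dirChanges, dirChanges, h3,
      ih _ w (List.nodup_cons.1 hnd).2 fun x hx => hN x (List.mem_cons_of_mem _ hx), Bool.not_not]
    congr 1
    cases b <;> cases decide (v < w) <;> simp

theorem permWord_rev {n : ℕ} (π : Equiv.Perm (Fin n)) :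
    permWord (Fin.revPerm * π : Equiv.Perm (Fin n)) =
      (permWord π).map fun x => n + 1 - x := by
  simp only [permWord, List.map_ofFn]
  congr 1
  funext i
  have := (π i).2
  simp [Fin.val_rev]
  omega

/-- A permutation starting with an ascent has `as = run`, one starting with a descent has `as = run
+ 1`. Complementing exchanges the two kinds and preserves runs. -/
theorem pow_longestAlternating_add {n : ℕ} (hn : 2 ≤ n) (π : Equiv.Perm (Fin n)) :
    (X : ℤ[X]) ^ longestAlternating π +
      X ^ longestAlternating (Fin.revPerm * π : Equiv.Perm (Fin n)) =
        (1 + X) * X ^ runCount π := by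
  rw [longestAlternating_eq, longestAlternating_eq, permWord_rev]
  have hnd := nodup_permWord π
  have hmem : ∀ x ∈ permWord π, 0 < x ∧ x ≤ n := by
    intro x hx
    obtain ⟨i, rfl⟩ := (List.mem_ofFn' _ _).1 hx
    exact ⟨Nat.succ_pos _, (π i).2⟩
  have hlen : (permWord π).length = n := by simp [permWord]
  obtain ⟨v, w, L, h⟩ : ∃ v w L, permWord π = v :: w :: L := by
    rcases h : permWord π with _ | ⟨v, _ | ⟨w, L⟩⟩
    · simp [h] at hlen; omega
    · simp [h] at hlen; omega
    · exact ⟨v, w, L, rfl⟩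
  rw [runCount_eq π h]
  rw [h] at hnd hmem ⊢
  have hv := hmem v (by simp)
  have e1 : dirChanges false 0 (v :: w :: L) = 1 + dirChanges true v (w :: L) := by
    simp [dirChanges, hv.1]
  have e2 : dirChanges false 0 ((v :: w :: L).map fun x => n + 1 - x) =
      1 + dirChanges false v (w :: L) := by
    rw [← Bool.not_true, ← dirChanges_complement (n + 1) (w :: L) true v hnd fun x hx =>
      (hmem x hx).2.trans (Nat.le_succ n), List.map_cons, dirChanges]
    have : 0 < n + 1 - v := by omega
    simp [this]
  rw [e1, e2, dirChanges, dirChanges]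
  cases decide (v < w) <;> simp <;> ring

theorem two_mul_upDownRunPoly {n : ℕ} (hn : 2 ≤ n) :
    2 * upDownRunPoly n = (1 + X) * altRunPoly n := by
  have h : upDownRunPoly n = ∑ π : Equiv.Perm (Fin n),
      (X : ℤ[X]) ^ longestAlternating (Fin.revPerm * π : Equiv.Perm (Fin n)) :=
    (Equiv.sum_comp (Equiv.mulLeft (Fin.revPerm : Equiv.Perm (Fin n)))
      fun π => (X : ℤ[X]) ^ longestAlternating π).symm
  rw [two_mul]
  nth_rewrite 2 [h]
  rw [upDownRunPoly, altRunPoly, ← Finset.sum_add_distrib, Finset.mul_sum]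
  exact Finset.sum_congr rfl fun π _ => pow_longestAlternating_add hn π

theorem altRunPoly_one : altRunPoly 1 = 1 := by
  have h : ∀ π : Equiv.Perm (Fin 1), runCount π = 0 := by
    intro π
    classical
    unfold runCount
    rw [Finset.card_eq_zero, Finset.filter_eq_empty_iff]
    rintro ⟨i, j⟩ - h
    exact absurd h.1.1 (by simp [Subsingleton.elim i j])
  simp [altRunPoly, h]

theorem one_add_X_ne_zero : (1 + X : ℤ[X]) ≠ 0 := by
  rw [add_comm]; exact X_add_C_ne_zero (1 : ℤ)

theorem two_mul_upDownRunPoly_sub (r : ℕ) (hr : 1 ≤ r) :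
    2 * upDownRunPoly r = (1 + X) * altRunPoly r + if r = 1 then X - 1 else 0 := by
  rcases hr.eq_or_lt with rfl | hr
  · rw [upDownRunPoly_eq, wordPoly_one, altRunPoly_one, if_pos rfl]; ring
  · rw [two_mul_upDownRunPoly hr, if_neg (by omega), add_zero]

theorem altRunPoly_convolution (n : ℕ) (hn : 1 ≤ n) :
    altRunPoly (n + 1) =
      (-1) ^ (n - 1) * (X - 1) * (1 - X ^ 2) ^ ((n - 1) / 2) +
      (1 + X) * ∑ r ∈ Finset.Icc 2 (n + 1),
        (n.choose (r - 2) : ℤ[X]) * (-1) ^ (n + 1 - r) * (1 - X ^ 2) ^ ((n + 1 - r) / 2) *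
          altRunPoly (r - 1) := by
  refine mul_left_cancel₀ one_add_X_ne_zero ?_
  have hsum : ∑ r ∈ Finset.Icc 2 (n + 1),
      (n.choose (r - 2) : ℤ[X]) * (-1) ^ (n + 1 - r) * (1 - X ^ 2) ^ ((n + 1 - r) / 2) *
          altRunPoly (r - 1) = ∑ r ∈ Finset.Icc 1 n,
      (n.choose (r - 1) : ℤ[X]) * (-1) ^ (n - r) * (1 - X ^ 2) ^ ((n - r) / 2) *
          altRunPoly r := by
    rw [← Finset.map_add_right_Icc 1 n 1, Finset.sum_map]
    refine Finset.sum_congr rfl fun r _ => ?_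
    simp
  -- The defect `X - 1` at `r = 1` produces the inhomogeneous term.
  have hdouble : 2 * ∑ r ∈ Finset.Icc 1 n,
      (n.choose (r - 1) : ℤ[X]) * (-1) ^ (n - r) * (1 - X ^ 2) ^ ((n - r) / 2) *
          upDownRunPoly r =
      (1 + X) * ∑ r ∈ Finset.Icc 1 n,
        (n.choose (r - 1) : ℤ[X]) * (-1) ^ (n - r) * (1 - X ^ 2) ^ ((n - r) / 2) *
          altRunPoly r + (-1) ^ (n - 1) * (X - 1) * (1 - X ^ 2) ^ ((n - 1) / 2) := by
    rw [Finset.mul_sum]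
    simp only [mul_left_comm (2 : ℤ[X])]
    rw [Finset.sum_congr rfl fun r hr => by
      rw [two_mul_upDownRunPoly_sub r (Finset.mem_Icc.1 hr).1, mul_add, mul_left_comm],
      Finset.sum_add_distrib, ← Finset.mul_sum]
    simp only [mul_ite, mul_zero]
    rw [Finset.sum_ite_eq' (Finset.Icc 1 n) 1, if_pos (Finset.mem_Icc.2 ⟨le_rfl, hn⟩)]
    simp only [Nat.sub_self, Nat.choose_zero_right, Nat.cast_one]
    ring
  rw [hsum, ← two_mul_upDownRunPoly (by omega), upDownRunPoly_eq, wordPoly_convolution n hn,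
    mul_left_comm]
  simp only [← upDownRunPoly_eq]
  rw [hdouble]
  ring

theorem pow_dvd_altRunPoly (n : ℕ) (hn : 1 ≤ n) : (1 + X) ^ (n / 2 - 1) ∣ altRunPoly n := by
  rcases Nat.lt_or_ge n 2 with h | h
  · simp [show n / 2 - 1 = 0 by omega]
  · have hd : (1 + X) ^ (n / 2) ∣ (1 + X) * altRunPoly n := by
      rw [← two_mul_upDownRunPoly h, upDownRunPoly_eq]
      exact (pow_dvd_wordPoly n hn).mul_left 2
    rw [show n / 2 = (n / 2 - 1) + 1 by omega, pow_succ'] at hd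
    exact (mul_dvd_mul_iff_left one_add_X_ne_zero).1 hd

theorem mainTheorem10 :
    (∀ n : ℕ, 1 ≤ n →
      upDownRunPoly (n + 1) =
        (1 + X) * ∑ r ∈ Finset.Icc 1 n,
          (n.choose (r - 1) : ℤ[X]) * (-1) ^ (n - r) * (1 - X ^ 2) ^ ((n - r) / 2) *
            upDownRunPoly r) ∧
    (∀ n : ℕ, 1 ≤ n →
      altRunPoly (n + 1) =
        (-1) ^ (n - 1) * (X - 1) * (1 - X ^ 2) ^ ((n - 1) / 2) +
        (1 + X) * ∑ r ∈ Finset.Icc 2 (n + 1),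
          (n.choose (r - 2) : ℤ[X]) * (-1) ^ (n + 1 - r) * (1 - X ^ 2) ^ ((n + 1 - r) / 2) *
            altRunPoly (r - 1)) ∧
    (∀ n : ℕ, 1 ≤ n → (1 + X) ^ (n / 2) ∣ upDownRunPoly n) ∧
    (∀ n : ℕ, 1 ≤ n → (1 + X) ^ (n / 2 - 1) ∣ altRunPoly n) := by

  refine ⟨fun n hn => ?_, altRunPoly_convolution, fun n hn => ?_, pow_dvd_altRunPoly⟩
  · simp only [upDownRunPoly_eq]
    exact wordPoly_convolution n hn
  · rw [upDownRunPoly_eq]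
    exact pow_dvd_wordPoly n hn
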